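/- Let $\mathcal{H}_A,\mathcal{H}_B$ be separable complex Hilbert spaces and let $G$ be a positive semidefinite self-adjoint (possibly unbounded, densely defined) operator on $\mathcal{H}_A$ with positive square root $\sqrt G$. For a Hilbert space $\mathcal{K}$, a linear operator $V$ from $\mathcal{H}_A$ to $\mathcal{K}$ is called $\sqrt G$-bounded if its domain contains $\mathcal{D}(\sqrt G)$ and, for some $a,b\ge 0$, $$\|V\varphi\|^2\le a^2\|\varphi\|^2+b^2\|\sqrt G\varphi\|^2\qquad\text{for all }\varphi\in\mathcal{D}(\sqrt G);$$ it is called $\sqrt G$-infinitesimal if moreover the infimum of the numbers $b\ge0$ for which this holds with some $a\ge 0$ equals $0$. Let $\mathfrak{S}_G$ be the set of states $\rho$ on $\mathcal{H}_A$ (positive operators of trace one) with finite energy $\mathrm{Tr}\,G\rho<+\infty$, let $\mathfrak{T}_G$ be its linear span, and let $\mathfrak{T}(\mathcal{H}_B)$ be the space of trace class operators on $\mathcal{H}_B$. Given a linear map $\Phi:\mathfrak{T}_G\to\mathfrak{T}(\mathcal{H}_B)$, a representing operator of $\Phi$ is a $\sqrt G$-bounded operator $V$ from $\mathcal{H}_A$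 to $\mathcal{H}_B\otimes\mathcal{H}_E$, where $\mathcal{H}_E$ is some separable Hilbert space, such that $$\Phi(\rho)=\mathrm{Tr}_E\,V\rho V^*\qquad\text{for all }\rho\in\mathfrak{S}_G,$$ where $V\rho V^*:=\sum_i|V\varphi_i\rangle\langle V\varphi_i|$ for any decomposition $\rho=\sum_i|\varphi_i\rangle\langle\varphi_i|$ and $\mathrm{Tr}_E$ is the partial trace over $\mathcal{H}_E$. Let $\mathfrak{F}_G^0(A,B)$ be the cone of all linear maps $\Phi:\mathfrak{T}_G\to\mathfrak{T}(\mathcal{H}_B)$ that have at least one $\sqrt G$-infinitesimal representing operator (for some separable $\mathcal{H}_E$). If $\Phi\in\mathfrak{F}_G^0(A,B)$, then every representing operator $V$ of $\Phi$, with values in $\mathcal{H}_B\otimes\mathcal{H}_E$ for any separable Hilbert space $\mathcal{H}_E$, is $\sqrt G$-infinitesimal. -/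

import Mathlib

open scoped InnerProductSpace TensorProduct ENNReal ComplexOrder
open InnerProductSpace

universe uA uB uE uF

/-! ## Unbounded positive operators and their square roots -/

section SquareRoot

variable {H : Type*} [NormedAddCommGroup H] [InnerProductSpace ℂ H] [CompleteSpace H]

/-- An unbounded operator on a Hilbert space that is self-adjoint (in particular densely defined)
and positive semidefinite. -/
structure IsPositiveSelfAdjoint (G : H →ₗ.[ℂ] H) : Prop where
  selfAdjoint : IsSelfAdjoint G
  nonneg : ∀ x : G.domain, 0 ≤ (⟪G x, (x : H)⟫_ℂ).re

/-- `S` is the positive square root of `G`: it is positive and self-adjoint and `G = S ∘ S`,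
the domain of `S ∘ S` being the natural one. -/
structure IsPositiveSqrt (G S : H →ₗ.[ℂ] H) : Prop where
  positive : IsPositiveSelfAdjoint S
  sq : ∀ x y : H, (x, y) ∈ G.graph ↔ ∃ z : H, (x, z) ∈ S.graph ∧ (z, y) ∈ S.graph

theorem IsPositiveSelfAdjoint.inner_comm {G : H →ₗ.[ℂ] H} (hG : IsPositiveSelfAdjoint G)
    (x y : G.domain) : ⟪G x, (y : H)⟫_ℂ = ⟪(x : H), G y⟫_ℂ := by
  have h := LinearPMap.adjoint_isFormalAdjoint (T := G) hG.selfAdjoint.dense_domain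
  rw [LinearPMap.isSelfAdjoint_def.1 hG.selfAdjoint] at h
  exact h x y

theorem IsPositiveSelfAdjoint.mem_graph {G : H →ₗ.[ℂ] H} (hG : IsPositiveSelfAdjoint G)
    {y z : H} (h : ∀ x : G.domain, ⟪z, (x : H)⟫_ℂ = ⟪y, G x⟫_ℂ) : (y, z) ∈ G.graph := by
  have hd := hG.selfAdjoint.dense_domain
  have hs := LinearPMap.isSelfAdjoint_def.1 hG.selfAdjoint
  have hy : y ∈ G.adjoint.domain := LinearPMap.mem_adjoint_domain_of_exists y ⟨z, h⟩
  have hv : G.adjoint ⟨y, hy⟩ = z := LinearPMap.adjoint_apply_eq hd ⟨y, hy⟩ h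
  have : (y, z) ∈ G.adjoint.graph := by
    rw [← hv]; exact LinearPMap.mem_graph _ ⟨y, hy⟩
  rwa [hs] at this

/-- The resolvent `(1 + G)⁻¹`. -/
theorem IsPositiveSelfAdjoint.exists_resolvent {G : H →ₗ.[ℂ] H} (hG : IsPositiveSelfAdjoint G) :
    ∃ R : H →L[ℂ] H, 0 ≤ R ∧ R ≤ 1 ∧ (∀ w, (R w, w - R w) ∈ G.graph) ∧
      ∀ x : G.domain, R ((x : H) + G x) = x := by
  have key : ∀ x : G.domain, ‖(x : H)‖ ^ 2 + ‖G x‖ ^ 2 ≤ ‖(x : H) + G x‖ ^ 2 := by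
    intro x
    have h1 := hG.nonneg x
    rw [norm_add_sq (𝕜 := ℂ), ← inner_conj_symm]
    simp only [RCLike.re_to_complex, Complex.conj_re]
    linarith
  have b1 : ∀ x : G.domain, ‖(x : H)‖ ≤ ‖(x : H) + G x‖ := fun x =>
    abs_le_of_sq_le_sq' (by nlinarith [key x, sq_nonneg ‖G x‖]) (norm_nonneg _) |>.2
  have b2 : ∀ x : G.domain, ‖G x‖ ≤ ‖(x : H) + G x‖ := fun x =>
    abs_le_of_sq_le_sq' (by nlinarith [key x, sq_nonneg ‖(x : H)‖]) (norm_nonneg _) |>.2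
  have hcl : IsClosed (G.graph : Set (H × H)) := hG.selfAdjoint.isClosed
  have : CompleteSpace G.graph := hcl.completeSpace_coe
  let A : G.graph →L[ℂ] H :=
    (ContinuousLinearMap.fst ℂ H H + ContinuousLinearMap.snd ℂ H H).comp G.graph.subtypeL
  have hA : AntilipschitzWith 1 A := by
    refine ContinuousLinearMap.antilipschitz_of_bound A ?_
    rintro ⟨⟨p, q⟩, hp⟩
    obtain ⟨x, hx1, hx2⟩ := (LinearPMap.mem_graph_iff G).1 hp
    simp only at hx1 hx2
    subst hx1 hx2
    simp only [A, NNReal.coe_one, one_mul]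
    exact max_le (b1 x) (b2 x)
  have hrc : IsClosed (A.range : Set H) := by
    exact hA.isClosed_range A.uniformContinuous
  have : CompleteSpace A.range := hrc.completeSpace_coe
  have htop : A.range = ⊤ := by
    rw [← Submodule.orthogonal_eq_bot_iff, Submodule.eq_bot_iff]
    intro y hy
    have h0 : ∀ x : G.domain, ⟪(x : H) + G x, y⟫_ℂ = 0 := by
      intro x
      exact (Submodule.mem_orthogonal _ _).1 hy _ ⟨⟨_, LinearPMap.mem_graph G x⟩, rfl⟩
    have hg : (y, -y) ∈ G.graph := by
      refine hG.mem_graph fun x => ?_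
      have h1 := h0 x
      rw [inner_add_left] at h1
      have h2 := congrArg (starRingEnd ℂ) h1
      simp only [map_add, inner_conj_symm, map_zero] at h2
      rw [inner_neg_left]
      linear_combination -h2
    obtain ⟨x, hx1, hx2⟩ := (LinearPMap.mem_graph_iff G).1 hg
    simp only at hx1 hx2
    have h3 := b1 x
    rw [hx1, hx2] at h3
    simpa using h3
  choose p hp using fun w => (LinearMap.range_eq_top.1 htop w)
  have hinj : Function.Injective A := hA.injective
  let R₀ : H →ₗ[ℂ] H :=
    { toFun := fun w => (p w : H × H).1
      map_add' := fun v w => by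
        have : p (v + w) = p v + p w := hinj (by
          have h1 := hp (v + w); have h2 := hp v; have h3 := hp w
          simp only [ContinuousLinearMap.coe_coe] at h1 h2 h3
          rw [map_add, h1, h2, h3])
        rw [this]; rfl
      map_smul' := fun c w => by
        have : p (c • w) = c • p w := hinj (by
          have h1 := hp (c • w); have h2 := hp w
          simp only [ContinuousLinearMap.coe_coe] at h1 h2
          rw [map_smul, h1, h2])
        rw [this]; rfl }
  have hgr : ∀ w, (R₀ w, w - R₀ w) ∈ G.graph := by
    intro w
    have h1 : (p w : H × H).1 + (p w : H × H).2 = w := hp w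
    have h2 : ((p w : H × H).1, w - (p w : H × H).1) = (p w : H × H) :=
      Prod.ext rfl (by rw [sub_eq_iff_eq_add', h1])
    change ((p w : H × H).1, w - (p w : H × H).1) ∈ G.graph
    rw [h2]; exact (p w).2
  have hgr' : ∀ w, ∃ x : G.domain, (x : H) = R₀ w ∧ G x = w - R₀ w := fun w =>
    (LinearPMap.mem_graph_iff G).1 (hgr w)
  have hbd : ∀ w, ‖R₀ w‖ ≤ 1 * ‖w‖ := by
    intro w
    obtain ⟨x, hx1, hx2⟩ := hgr' w
    have := b1 x
    rw [hx2, hx1] at this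
    simpa using this
  let R : H →L[ℂ] H := R₀.mkContinuous 1 hbd
  have hsym : ∀ v w, ⟪R₀ v, w⟫_ℂ = ⟪v, R₀ w⟫_ℂ := by
    intro v w
    obtain ⟨x, hx1, hx2⟩ := hgr' v
    obtain ⟨y, hy1, hy2⟩ := hgr' w
    have h := hG.inner_comm x y
    rw [hx1, hx2, hy1, hy2, inner_sub_left, inner_sub_right] at h
    linear_combination -h
  have hposG : ∀ w, 0 ≤ (⟪w - R₀ w, R₀ w⟫_ℂ).re := by
    intro w
    obtain ⟨x, hx1, hx2⟩ := hgr' w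
    have := hG.nonneg x
    rwa [hx1, hx2] at this
  refine ⟨R, ?_, ?_, hgr, ?_⟩
  · rw [ContinuousLinearMap.nonneg_iff_isPositive]
    refine ⟨fun v w => hsym v w, fun w => ?_⟩
    have h := hposG w
    rw [inner_sub_left, Complex.sub_re] at h
    have h2 : 0 ≤ (⟪R₀ w, R₀ w⟫_ℂ).re := inner_self_nonneg (𝕜 := ℂ)
    have h3 : ⟪R₀ w, w⟫_ℂ = ⟪w, R₀ w⟫_ℂ := hsym w w
    change 0 ≤ (⟪R₀ w, w⟫_ℂ).re
    rw [h3]; linarith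
  · rw [ContinuousLinearMap.le_def]
    refine ⟨fun v w => ?_, fun w => ?_⟩
    · change ⟪v - R₀ v, w⟫_ℂ = ⟪v, w - R₀ w⟫_ℂ
      rw [inner_sub_left, inner_sub_right, hsym]
    · change 0 ≤ (⟪w - R₀ w, w⟫_ℂ).re
      have h := hposG w
      have h2 : 0 ≤ (⟪w - R₀ w, w - R₀ w⟫_ℂ).re := inner_self_nonneg (𝕜 := ℂ)
      rw [inner_sub_right, Complex.sub_re] at h2
      linarith
  · intro x
    obtain ⟨y, hy1, hy2⟩ := hgr' ((x : H) + G x)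
    have h := b1 (y - x)
    have h4 : ((y - x : G.domain) : H) + G (y - x) = 0 := by
      rw [LinearPMap.map_sub, hy2, Submodule.coe_sub, hy1]; abel
    rw [h4, norm_zero] at h
    have h5 := norm_le_zero_iff.1 h
    rw [Submodule.coe_sub, sub_eq_zero] at h5
    change R₀ ((x : H) + G x) = x
    rw [← hy1, h5]

/-- Every positive self-adjoint operator has a positive square root. -/
theorem IsPositiveSelfAdjoint.exists_sqrt {G : H →ₗ.[ℂ] H} (hG : IsPositiveSelfAdjoint G) :
    ∃ S : H →ₗ.[ℂ] H, IsPositiveSqrt G S := by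
  obtain ⟨R, hR0, hR1, hgr, hinv⟩ := hG.exists_resolvent
  have hRinj : ∀ w, R w = 0 → w = 0 := by
    intro w hw
    obtain ⟨x, hx1, hx2⟩ := (LinearPMap.mem_graph_iff G).1 (hgr w)
    simp only [hw, sub_zero] at hx1 hx2
    have : x = 0 := Subtype.ext hx1
    rw [← hx2, this, LinearPMap.map_zero]
  obtain ⟨T, C, hT, hC, hTT, hCC, hTC⟩ : ∃ T C : H →L[ℂ] H, 0 ≤ T ∧ 0 ≤ C ∧ T * T = R ∧
      C * C = 1 - R ∧ Commute T C := by
    refine ⟨CFC.sqrt R, CFC.sqrt (1 - R), CFC.sqrt_nonneg _, CFC.sqrt_nonneg _,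
      CFC.sqrt_mul_sqrt_self R hR0, CFC.sqrt_mul_sqrt_self _ (sub_nonneg.2 hR1), ?_⟩
    have h1 : Commute R (CFC.sqrt R) := by
      have h := CFC.sqrt_mul_sqrt_self R hR0
      generalize CFC.sqrt R = T at h
      rw [← h]; exact (Commute.refl T).mul_left (Commute.refl T)
    have h2 : Commute (1 - R) (CFC.sqrt R) := (Commute.one_left _).sub_left h1
    exact (Commute.cfcₙ_nnreal h2 NNReal.sqrt).symm
  have hTTx : ∀ x, T (T x) = R x := fun x => by rw [← hTT]; rfl
  have hCCx : ∀ x, C (C x) = x - R x := fun x => by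
    have := congrArg (fun f : H →L[ℂ] H => f x) hCC; exact this
  have hTCx : ∀ x, T (C x) = C (T x) := fun x =>
    congrArg (fun f : H →L[ℂ] H => f x) hTC.eq
  have hTinj : Function.Injective T := by
    rw [injective_iff_map_eq_zero]
    intro w hw
    exact hRinj w (by rw [← hTTx, hw, map_zero])
  have hTs : ∀ x y, ⟪T x, y⟫_ℂ = ⟪x, T y⟫_ℂ := fun x y =>
    ((ContinuousLinearMap.nonneg_iff_isPositive T).1 hT).inner_left_eq_inner_right x y
  have hCs : ∀ x y, ⟪C x, y⟫_ℂ = ⟪x, C y⟫_ℂ := fun x y =>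
    ((ContinuousLinearMap.nonneg_iff_isPositive C).1 hC).inner_left_eq_inner_right x y
  let e : H ≃ₗ[ℂ] T.range := LinearEquiv.ofInjective (T : H →ₗ[ℂ] H) hTinj
  let S : H →ₗ.[ℂ] H := ⟨T.range, (C : H →ₗ[ℂ] H).comp e.symm.toLinearMap⟩
  have hSe : ∀ u, S (e u) = C u := fun u => by
    change C (e.symm (e u)) = C u
    rw [e.symm_apply_apply]
  have hes : ∀ x : S.domain, ∃ u, e u = x := fun x => ⟨e.symm x, e.apply_symm_apply x⟩
  have heT : ∀ u, ((e u : T.range) : H) = T u := fun u => rfl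
  have hSg : ∀ x y, (x, y) ∈ S.graph ↔ ∃ u, T u = x ∧ C u = y := by
    intro x y
    rw [LinearPMap.mem_graph_iff]
    constructor
    · rintro ⟨z, hz1, hz2⟩
      obtain ⟨u, rfl⟩ := hes z
      exact ⟨u, hz1, (hSe u).symm.trans hz2⟩
    · rintro ⟨u, hu1, hu2⟩
      exact ⟨e u, hu1, (hSe u).trans hu2⟩
  have hdense : Dense (S.domain : Set H) := by
    change Dense (T.range : Set H)
    rw [Submodule.dense_iff_topologicalClosure_eq_top,
      Submodule.topologicalClosure_eq_top_iff, Submodule.eq_bot_iff]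
    intro y hy
    apply hTinj
    rw [map_zero, ← inner_self_eq_zero (𝕜 := ℂ), hTs, ← inner_conj_symm,
      (Submodule.mem_orthogonal _ _).1 hy (T (T y)) ⟨T y, rfl⟩, map_zero]
  have hSsym : S.IsFormalAdjoint S := by
    intro x y
    obtain ⟨u, rfl⟩ := hes x
    obtain ⟨v, rfl⟩ := hes y
    rw [hSe, hSe, heT, heT, hCs, hTs, hTCx]
  have hSsa : IsSelfAdjoint S := by
    rw [LinearPMap.isSelfAdjoint_def]
    refine le_antisymm ?_ (hSsym.le_adjoint hdense)
    refine LinearPMap.le_of_le_graph ?_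
    rintro ⟨y, z⟩ hyz
    obtain ⟨y', hy1, hy2⟩ := (LinearPMap.mem_graph_iff _).1 hyz
    simp only at hy1 hy2
    have hf := LinearPMap.adjoint_isFormalAdjoint hdense y'
    have h1 : C y = T z := by
      refine ext_inner_right ℂ fun u => ?_
      have := hf (e u)
      rw [hSe, heT, hy1, hy2] at this
      rw [hCs, hTs, this]
    rw [hSg]
    refine ⟨T y + C z, ?_, ?_⟩
    · rw [map_add, hTTx, hTCx, ← h1, hCCx]; abel
    · rw [map_add, hCCx, ← hTCx, h1, hTTx]; abel
  refine ⟨S, ⟨hSsa, fun x => ?_⟩, fun x y => ?_⟩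
  · obtain ⟨u, rfl⟩ := hes x
    rw [hSe, heT, ← hTs]
    exact ((ContinuousLinearMap.nonneg_iff_isPositive _).1 (hTC.mul_nonneg hT hC)).2 u
  · constructor
    · intro h
      obtain ⟨x', hx1, hx2⟩ := (LinearPMap.mem_graph_iff G).1 h
      simp only at hx1 hx2
      have h3 := hinv x'
      rw [hx1, hx2] at h3
      refine ⟨C (T (x + y)), (hSg _ _).2 ⟨T (x + y), by rw [hTTx, h3], rfl⟩,
        (hSg _ _).2 ⟨C (x + y), hTCx _, ?_⟩⟩
      rw [hCCx, h3]; abel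
    · rintro ⟨z, h1, h2⟩
      obtain ⟨u, hu1, hu2⟩ := (hSg _ _).1 h1
      obtain ⟨v, hv1, hv2⟩ := (hSg _ _).1 h2
      have h3 : u = T (T u + C v) := by
        rw [map_add, hTTx, hTCx, hv1, ← hu2, hCCx]; abel
      have h4 : x = R (T u + C v) := by rw [← hTTx, ← h3, hu1]
      have h5 : y = (T u + C v) - x := by
        rw [hu1, hv2]; abel
      rw [h5, h4]
      exact hgr _

/-- The positive square root `√G` of a positive self-adjoint operator `G`. -/
noncomputable def posSqrt (G : H →ₗ.[ℂ] H) (hG : IsPositiveSelfAdjoint G) : H →ₗ.[ℂ] H :=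
  Classical.choose hG.exists_sqrt

theorem posSqrt_spec (G : H →ₗ.[ℂ] H) (hG : IsPositiveSelfAdjoint G) :
    IsPositiveSqrt G (posSqrt G hG) :=
  Classical.choose_spec hG.exists_sqrt

end SquareRoot

/-! ## Relatively bounded and infinitesimal operators -/

section RelativelyBounded

variable {H K : Type*} [NormedAddCommGroup H] [InnerProductSpace ℂ H]
  [NormedAddCommGroup K] [InnerProductSpace ℂ K]

/-- `‖A x‖² ≤ a² ‖x‖² + b² ‖S x‖²` for all `x` in the domain of `S` (used when the domain of `A`
contains that of `S`). -/
def RelBoundedBy (S : H →ₗ.[ℂ] H) (A : H →ₗ.[ℂ] K) (a b : ℝ) : Prop :=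
  ∀ (x : H) (hS : x ∈ S.domain) (hA : x ∈ A.domain),
    ‖A ⟨x, hA⟩‖ ^ 2 ≤ a ^ 2 * ‖x‖ ^ 2 + b ^ 2 * ‖S ⟨x, hS⟩‖ ^ 2

/-- `A` is relatively bounded with respect to `S` (briefly, `S`-bounded). -/
def IsRelBounded (S : H →ₗ.[ℂ] H) (A : H →ₗ.[ℂ] K) : Prop :=
  S.domain ≤ A.domain ∧ ∃ a b : ℝ, 0 ≤ a ∧ 0 ≤ b ∧ RelBoundedBy S A a b

/-- The `S`-bound of an `S`-bounded operator `A`. -/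
noncomputable def relBound (S : H →ₗ.[ℂ] H) (A : H →ₗ.[ℂ] K) : ℝ :=
  sInf {b : ℝ | 0 ≤ b ∧ ∃ a : ℝ, 0 ≤ a ∧ RelBoundedBy S A a b}

/-- `A` is `S`-infinitesimal: it is `S`-bounded with `S`-bound equal to zero. -/
def IsInfinitesimal (S : H →ₗ.[ℂ] H) (A : H →ₗ.[ℂ] K) : Prop :=
  IsRelBounded S A ∧ relBound S A = 0

end RelativelyBounded

/-! ## Trace class operators, traces and partial traces -/

section TraceClass

/-- An index set for a Hilbert basis of `H`. -/
def stdBasisIndex (H : Type*) [NormedAddCommGroup H] [InnerProductSpace ℂ H] [CompleteSpace H] :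
    Set H :=
  Classical.choose (exists_hilbertBasis ℂ H)

/-- A Hilbert (complete orthonormal) basis of `H`. The traces below do not depend on its choice. -/
noncomputable def stdBasis (H : Type*) [NormedAddCommGroup H] [InnerProductSpace ℂ H]
    [CompleteSpace H] : HilbertBasis (stdBasisIndex H) ℂ H :=
  Classical.choose (Classical.choose_spec (exists_hilbertBasis ℂ H))

/-- The space of trace class operators on `H`: the operators `T = ∑ₙ |aₙ⟩⟨bₙ|` with
`∑ₙ ‖aₙ‖ ‖bₙ‖ < ∞`. -/
def traceClass (H : Type*) [NormedAddCommGroup H] [InnerProductSpace ℂ H] :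
    Submodule ℂ (H →L[ℂ] H) where
  carrier := {T | ∃ a b : ℕ → H, Summable (fun n => ‖a n‖ * ‖b n‖) ∧
    HasSum (fun n => rankOne ℂ (a n) (b n)) T}
  zero_mem' := ⟨0, 0, by simp, by simp⟩
  add_mem' := by
    rintro T U ⟨a, b, h1, h2⟩ ⟨c, d, h3, h4⟩
    let e : ℕ ≃ ℕ ⊕ ℕ := Equiv.natSumNatEquivNat.symm
    refine ⟨Sum.elim a c ∘ e, Sum.elim b d ∘ e, ?_, ?_⟩
    · refine (e.summable_iff (f := fun s => ‖Sum.elim a c s‖ * ‖Sum.elim b d s‖)).2 ?_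
      exact (HasSum.sum (f := fun s => ‖Sum.elim a c s‖ * ‖Sum.elim b d s‖)
        h1.hasSum h3.hasSum).summable
    · refine (e.hasSum_iff
        (f := fun s => rankOne ℂ (Sum.elim a c s) (Sum.elim b d s))).2 ?_
      exact HasSum.sum (f := fun s => rankOne ℂ (Sum.elim a c s) (Sum.elim b d s)) h2 h4
  smul_mem' := by
    rintro z T ⟨a, b, h1, h2⟩
    refine ⟨fun n => z • a n, b, ?_, ?_⟩
    · simpa [norm_smul, mul_assoc] using h1.mul_left ‖z‖
    · simpa using h2.const_smul z

/-- The trace of a trace class operator. -/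
noncomputable def opTrace {H : Type*} [NormedAddCommGroup H] [InnerProductSpace ℂ H]
    [CompleteSpace H] (T : H →L[ℂ] H) : ℂ :=
  ∑' i, ⟪stdBasis H i, T (stdBasis H i)⟫_ℂ

/-- The Hilbert space tensor product: the completion of the algebraic one. -/
abbrev HilbertTensor (H K : Type*) [NormedAddCommGroup H] [InnerProductSpace ℂ H]
    [NormedAddCommGroup K] [InnerProductSpace ℂ K] : Type _ :=
  UniformSpace.Completion (H ⊗[ℂ] K)

/-- The bounded operator `x ↦ x ⊗ f` from `H` to the Hilbert tensor product of `H` and `K`. -/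
noncomputable def tensorRight (H : Type*) {K : Type*} [NormedAddCommGroup H]
    [InnerProductSpace ℂ H] [NormedAddCommGroup K] [InnerProductSpace ℂ K] (f : K) :
    H →L[ℂ] HilbertTensor H K :=
  (UniformSpace.Completion.toComplL (𝕜 := ℂ) (E := H ⊗[ℂ] K)).comp
    ((TensorProduct.mkL ℂ H K).flip f)

/-- The partial trace over `K` of a trace class operator `T` on `H ⊗ K`: with `Jₖ x = x ⊗ fₖ` for
a Hilbert basis `f` of `K`, it is the sum `∑ₖ Jₖ* T Jₖ`, which converges in trace norm. -/
noncomputable def partialTrace {H K : Type*} [NormedAddCommGroup H] [InnerProductSpace ℂ H]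
    [CompleteSpace H] [NormedAddCommGroup K] [InnerProductSpace ℂ K] [CompleteSpace K]
    (T : HilbertTensor H K →L[ℂ] HilbertTensor H K) : H →L[ℂ] H :=
  ∑' k, (ContinuousLinearMap.adjoint (tensorRight H (stdBasis K k))).comp
    (T.comp (tensorRight H (stdBasis K k)))

end TraceClass

/-! ## States of finite energy and Stinespring-like representations -/

section Cone

/-- States (density operators): positive trace class operators with unit trace. -/
def IsState {H : Type*} [NormedAddCommGroup H] [InnerProductSpace ℂ H] [CompleteSpace H]
    (ρ : H →L[ℂ] H) : Prop :=
  ρ.IsPositive ∧ ρ ∈ traceClass H ∧ opTrace ρ = 1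

open Classical in
/-- The quadratic form `‖√G x‖²` of `G`, equal to `∞` outside the domain of `√G`. -/
noncomputable def energyForm {H : Type*} [NormedAddCommGroup H] [InnerProductSpace ℂ H]
    [CompleteSpace H] (G : H →ₗ.[ℂ] H) (hG : IsPositiveSelfAdjoint G) (x : H) : ℝ≥0∞ :=
  if h : x ∈ (posSqrt G hG).domain then ‖posSqrt G hG ⟨x, h⟩‖ₑ ^ 2 else ∞

/-- The energy `Tr Gρ ∈ [0, ∞]` of a positive operator `ρ`, that is `∑ᵢ ‖√G √ρ eᵢ‖²` for a Hilbert
basis `e`. -/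
noncomputable def energy {H : Type*} [NormedAddCommGroup H] [InnerProductSpace ℂ H]
    [CompleteSpace H] (G : H →ₗ.[ℂ] H) (hG : IsPositiveSelfAdjoint G) (ρ : H →L[ℂ] H) : ℝ≥0∞ :=
  ∑' i, energyForm G hG (CFC.sqrt ρ (stdBasis H i))

/-- The set of states with finite energy. -/
def finiteEnergyStates {H : Type*} [NormedAddCommGroup H] [InnerProductSpace ℂ H]
    [CompleteSpace H] (G : H →ₗ.[ℂ] H) (hG : IsPositiveSelfAdjoint G) : Set (H →L[ℂ] H) :=
  {ρ | IsState ρ ∧ energy G hG ρ < ∞}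

/-- The linear span of the states with finite energy. -/
def finiteEnergySpan {H : Type*} [NormedAddCommGroup H] [InnerProductSpace ℂ H]
    [CompleteSpace H] (G : H →ₗ.[ℂ] H) (hG : IsPositiveSelfAdjoint G) :
    Submodule ℂ (H →L[ℂ] H) :=
  Submodule.span ℂ (finiteEnergyStates G hG)

/-- `T = V ρ V*` in the sense that `T = ∑ᵢ |V φᵢ⟩⟨V φᵢ|` for any decomposition
`ρ = ∑ᵢ |φᵢ⟩⟨φᵢ|`. (If `ρ` has finite energy and `V` is `√G`-bounded, then the vectors of any
decomposition of `ρ` lie in the domain of `√G`, hence in that of `V`.) -/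
def IsSandwich {H K : Type*} [NormedAddCommGroup H] [InnerProductSpace ℂ H] [CompleteSpace H]
    [NormedAddCommGroup K] [InnerProductSpace ℂ K] [CompleteSpace K]
    (V : H →ₗ.[ℂ] K) (ρ : H →L[ℂ] H) (T : K →L[ℂ] K) : Prop :=
  ∀ φ : ℕ → V.domain, HasSum (fun i => rankOne ℂ (φ i : H) (φ i : H)) ρ →
    HasSum (fun i => rankOne ℂ (V (φ i)) (V (φ i))) T

/-- `V` is a representing operator of the linear map `Φ`: it is a `√G`-bounded operator from `HA`
to `HB ⊗ HE` and `Φ(ρ) = Tr_E V ρ V*` for all states `ρ` with finite energy. -/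
def IsRepresenting {HA HB HE : Type*}
    [NormedAddCommGroup HA] [InnerProductSpace ℂ HA] [CompleteSpace HA]
    [NormedAddCommGroup HB] [InnerProductSpace ℂ HB] [CompleteSpace HB]
    [NormedAddCommGroup HE] [InnerProductSpace ℂ HE] [CompleteSpace HE]
    (G : HA →ₗ.[ℂ] HA) (hG : IsPositiveSelfAdjoint G)
    (Φ : finiteEnergySpan G hG →ₗ[ℂ] traceClass HB) (V : HA →ₗ.[ℂ] HilbertTensor HB HE) : Prop :=
  IsRelBounded (posSqrt G hG) V ∧
    ∀ (ρ : HA →L[ℂ] HA) (hρ : ρ ∈ finiteEnergyStates G hG),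
      ∃ T : HilbertTensor HB HE →L[ℂ] HilbertTensor HB HE, IsSandwich V ρ T ∧
        (Φ ⟨ρ, Submodule.subset_span hρ⟩ : HB →L[ℂ] HB) = partialTrace T

/-- The cone of linear maps, from the span of the finite energy states on `HA` to the trace class
operators on `HB`, that have some `√G`-infinitesimal representing operator with values in
`HB ⊗ HE`, for some separable Hilbert space `HE`. -/
def infinitesimalCone.{vE, vA, vB} {HA : Type vA} (HB : Type vB)
    [NormedAddCommGroup HA] [InnerProductSpace ℂ HA] [CompleteSpace HA]
    [NormedAddCommGroup HB] [InnerProductSpace ℂ HB] [CompleteSpace HB]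
    (G : HA →ₗ.[ℂ] HA) (hG : IsPositiveSelfAdjoint G) :
    Set (finiteEnergySpan G hG →ₗ[ℂ] traceClass HB) :=
  {Φ | ∃ (HE : Type vE) (_ : NormedAddCommGroup HE) (_ : InnerProductSpace ℂ HE)
    (_ : CompleteSpace HE) (_ : TopologicalSpace.SeparableSpace HE)
    (V : HA →ₗ.[ℂ] HilbertTensor HB HE),
      IsRepresenting G hG Φ V ∧ IsInfinitesimal (posSqrt G hG) V}

end Cone

/-! The norm of a representing operator can be read off from the map it represents. For a unit
vector `x` in the domain of `√G`, the projection `|x⟩⟨x|` is a state of finite energy, the sandwich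
is forced to be `|Vx⟩⟨Vx|` (`IsSandwich.eq_rankOne`), and the partial trace preserves its trace
(`opTrace_partialTrace_rankOne_self`), so `Tr Φ(|x⟩⟨x|) = ‖Vx‖²` (`IsRepresenting.opTrace_eq`).

The left side does not involve `V`. By scaling, any two representing operators of `Φ` have equal
norms at every vector of `D(√G)` (`IsRepresenting.norm_apply_eq`), even when their environment
spaces differ. They therefore satisfy the same estimates with the same pairs `(a, b)` and share one
`√G`-bound; if it vanishes for one of them, it vanishes for all. Pure states suffice because
relative boundedness is tested on single vectors. -/

/-! ### Hilbert bases of tensor products -/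

section HilbertBasis

variable {ι κ H K : Type*} [NormedAddCommGroup H] [InnerProductSpace ℂ H]
  [NormedAddCommGroup K] [InnerProductSpace ℂ K]

/-- A vector orthogonal to a Hilbert basis vanishes. -/
theorem HilbertBasis.eq_zero_of_inner_eq_zero (b : HilbertBasis ι ℂ H) {x : H}
    (h : ∀ i, ⟪b i, x⟫_ℂ = 0) : x = 0 := by
  apply b.repr.injective
  ext i
  simp [b.repr_apply_apply, h]

/-- Parseval's identity. -/
theorem HilbertBasis.hasSum_norm_sq_inner (b : HilbertBasis ι ℂ H) (x : H) :
    HasSum (fun i => ‖⟪b i, x⟫_ℂ‖ ^ 2) (‖x‖ ^ 2) := by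
  have h := b.hasSum_inner_mul_inner x x
  rw [inner_self_eq_norm_sq_to_K] at h
  have h2 : ∀ i, ⟪x, b i⟫_ℂ * ⟪b i, x⟫_ℂ = ((‖⟪b i, x⟫_ℂ‖ ^ 2 : ℝ) : ℂ) := by
    intro i
    rw [← inner_conj_symm, Complex.conj_mul']
    push_cast
    rfl
  simp only [h2] at h
  exact Complex.hasSum_ofReal.1 (by simpa using h)

theorem tensorRight_apply (x : H) (y : K) :
    tensorRight H y x = ((x ⊗ₜ[ℂ] y : H ⊗[ℂ] K) : HilbertTensor H K) := rfl

theorem inner_tensorRight (x x' : H) (y y' : K) :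
    ⟪tensorRight H y x, tensorRight H y' x'⟫_ℂ = ⟪x, x'⟫_ℂ * ⟪y, y'⟫_ℂ := by
  rw [tensorRight_apply, tensorRight_apply, UniformSpace.Completion.inner_coe,
    TensorProduct.inner_tmul]

/-- A vector of the Hilbert tensor product that is orthogonal to all simple tensors vanishes. -/
theorem HilbertTensor.eq_zero_of_inner_tmul {ψ : HilbertTensor H K}
    (h : ∀ (x : H) (y : K), ⟪tensorRight H y x, ψ⟫_ℂ = 0) : ψ = 0 := by
  have h1 : ∀ t : H ⊗[ℂ] K, ⟪(t : HilbertTensor H K), ψ⟫_ℂ = 0 := by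
    intro t
    induction t with
    | zero => exact inner_zero_left ψ
    | tmul x y => exact h x y
    | add s t hs ht => rw [UniformSpace.Completion.coe_add, inner_add_left, hs, ht, add_zero]
  have h2 : ∀ t : HilbertTensor H K, ⟪t, ψ⟫_ℂ = 0 := fun t =>
    UniformSpace.Completion.induction_on t
      (isClosed_eq (by fun_prop) continuous_const) h1
  exact inner_self_eq_zero.1 (h2 ψ)

theorem HilbertBasis.orthonormal_tensorRight (b : HilbertBasis ι ℂ H) (c : HilbertBasis κ ℂ K) :
    Orthonormal ℂ (fun p : ι × κ => tensorRight H (c p.2) (b p.1)) := by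
  classical
  rw [orthonormal_iff_ite]
  rintro ⟨i, k⟩ ⟨j, l⟩
  rw [inner_tensorRight, orthonormal_iff_ite.1 b.orthonormal, orthonormal_iff_ite.1 c.orthonormal]
  by_cases h1 : i = j <;> by_cases h2 : k = l <;> simp [h1, h2]

theorem inner_rankOne_self (x y : H) :
    ⟪y, rankOne ℂ x x y⟫_ℂ = ((‖⟪y, x⟫_ℂ‖ ^ 2 : ℝ) : ℂ) := by
  rw [rankOne_apply, inner_smul_right, ← inner_conj_symm x y, Complex.conj_mul']
  push_cast
  rfl

variable [CompleteSpace H] [CompleteSpace K]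

/-- The products of the elements of two Hilbert bases form a Hilbert basis of the Hilbert tensor
product. -/
noncomputable def HilbertBasis.hilbertTensor (b : HilbertBasis ι ℂ H) (c : HilbertBasis κ ℂ K) :
    HilbertBasis (ι × κ) ℂ (HilbertTensor H K) :=
  HilbertBasis.mkOfOrthogonalEqBot (b.orthonormal_tensorRight c) <| by
    rw [Submodule.eq_bot_iff]
    intro ψ hψ
    have h0 : ∀ i k, ⟪tensorRight H (c k) (b i), ψ⟫_ℂ = 0 := fun i k =>
      (Submodule.mem_orthogonal _ _).1 hψ _ (Submodule.subset_span ⟨(i, k), rfl⟩)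
    -- Orthogonality passes from basis vectors to all vectors one factor at a time: the adjoint of a
    -- slice map sends `ψ` to a vector orthogonal to a basis of that factor.
    have h1 : ∀ x k, ⟪tensorRight H (c k) x, ψ⟫_ℂ = 0 := by
      intro x k
      have := b.eq_zero_of_inner_eq_zero (x := (tensorRight H (c k)).adjoint ψ) fun i => by
        rw [ContinuousLinearMap.adjoint_inner_right, h0]
      rw [← ContinuousLinearMap.adjoint_inner_right, this, inner_zero_right]
    refine HilbertTensor.eq_zero_of_inner_tmul fun x y => ?_
    -- The slice in the other variable, `y ↦ x ⊗ y`.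
    let L : K →L[ℂ] HilbertTensor H K :=
      (UniformSpace.Completion.toComplL (𝕜 := ℂ) (E := H ⊗[ℂ] K)).comp (TensorProduct.mkL ℂ H K x)
    have := c.eq_zero_of_inner_eq_zero (x := L.adjoint ψ) fun k => by
      rw [ContinuousLinearMap.adjoint_inner_right]
      exact h1 x k
    change ⟪L y, ψ⟫_ℂ = 0
    rw [← ContinuousLinearMap.adjoint_inner_right, this, inner_zero_right]

theorem HilbertBasis.hilbertTensor_apply (b : HilbertBasis ι ℂ H) (c : HilbertBasis κ ℂ K)
    (i : ι) (k : κ) : b.hilbertTensor c (i, k) = tensorRight H (c k) (b i) := by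
  rw [HilbertBasis.hilbertTensor, HilbertBasis.coe_mkOfOrthogonalEqBot]

end HilbertBasis

/-! ### Traces, pure states and their energy -/

section Traces

variable {H K : Type*} [NormedAddCommGroup H] [InnerProductSpace ℂ H] [CompleteSpace H]
  [NormedAddCommGroup K] [InnerProductSpace ℂ K] [CompleteSpace K]

theorem opTrace_rankOne_self (x : H) : opTrace (rankOne ℂ x x) = ((‖x‖ ^ 2 : ℝ) : ℂ) := by
  unfold opTrace
  simp only [inner_rankOne_self]
  exact (Complex.hasSum_ofReal.2 ((stdBasis H).hasSum_norm_sq_inner x)).tsum_eq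

/-- The partial trace preserves the trace of `|ψ⟩⟨ψ|`. -/
theorem opTrace_partialTrace_rankOne_self (ψ : HilbertTensor H K) :
    opTrace (partialTrace (rankOne ℂ ψ ψ)) = ((‖ψ‖ ^ 2 : ℝ) : ℂ) := by
  let b := stdBasis H
  let c := stdBasis K
  -- The components of `ψ` along the basis of `K`: formally `ψ = ∑ₖ χₖ ⊗ cₖ`, so the partial trace
  -- of `|ψ⟩⟨ψ|` should be `∑ₖ |χₖ⟩⟨χₖ|`.
  let χ : stdBasisIndex K → H := fun k => (tensorRight H (c k)).adjoint ψ
  have hterm : ∀ k, ((tensorRight H (c k)).adjoint).comp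
      ((rankOne ℂ ψ ψ).comp (tensorRight H (c k))) = rankOne ℂ (χ k) (χ k) := by
    intro k
    rw [rankOne_comp, comp_rankOne]
  -- Parseval in the product basis. Summing this family over `i` first gives `∑ₖ ‖χₖ‖² < ∞`; summing
  -- over `k` first gives the trace.
  have htot : HasSum (fun p : stdBasisIndex H × stdBasisIndex K => ‖⟪b p.1, χ p.2⟫_ℂ‖ ^ 2)
      (‖ψ‖ ^ 2) := by
    convert (b.hilbertTensor c).hasSum_norm_sq_inner ψ using 4 with p
    rw [← Prod.mk.eta (p := p), HilbertBasis.hilbertTensor_apply,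
      ContinuousLinearMap.adjoint_inner_right]
  have hχ : Summable fun k => ‖χ k‖ ^ 2 := by
    have h := htot.summable.prod_symm.prod
    refine h.congr fun k => ?_
    exact (b.hasSum_norm_sq_inner (χ k)).tsum_eq
  -- Summability must be proved, since a divergent `tsum` is zero by convention; here the series
  -- converges absolutely in operator norm, as `‖|χₖ⟩⟨χₖ|‖ = ‖χₖ‖²`.
  have hop : HasSum (fun k => rankOne ℂ (χ k) (χ k)) (partialTrace (rankOne ℂ ψ ψ)) := by
    have hs : Summable fun k => rankOne ℂ (χ k) (χ k) :=
      Summable.of_norm (by simpa only [norm_rankOne, ← sq] using hχ)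
    unfold partialTrace
    simp only [c] at hterm
    simp only [hterm]
    exact hs.hasSum
  have hdiag : ∀ i, HasSum (fun k => ((‖⟪b i, χ k⟫_ℂ‖ ^ 2 : ℝ) : ℂ))
      ⟪b i, partialTrace (rankOne ℂ ψ ψ) (b i)⟫_ℂ := by
    intro i
    -- A diagonal entry is a continuous linear functional of the operator, so it passes through the
    -- sum.
    have h := hop.mapL ((innerSL ℂ (b i)).comp (ContinuousLinearMap.apply ℂ H (b i)))
    simpa only [ContinuousLinearMap.comp_apply, ContinuousLinearMap.apply_apply,
      innerSL_apply_apply, inner_rankOne_self] using h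
  exact ((Complex.hasSum_ofReal.2 htot).prod_fiberwise hdiag).tsum_eq

theorem rankOne_mem_traceClass (x y : H) : rankOne ℂ x y ∈ traceClass H := by
  refine ⟨Pi.single 0 x, Pi.single 0 y, ?_, ?_⟩
  · refine summable_of_ne_finset_zero (s := {0}) fun n hn => ?_
    simp [Pi.single_eq_of_ne (Finset.notMem_singleton.1 hn)]
  · convert hasSum_single (f := fun n : ℕ => rankOne ℂ (Pi.single (M := fun _ => H) 0 x n)
      (Pi.single (M := fun _ => H) 0 y n)) 0 fun n hn => ?_
    · simp
    · simp
    · simp [Pi.single_eq_of_ne hn]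

theorem isState_rankOne_self {x : H} (hx : ‖x‖ = 1) : IsState (rankOne ℂ x x) :=
  ⟨isPositive_rankOne_self x, rankOne_mem_traceClass x x, by simp [opTrace_rankOne_self, hx]⟩

/-- A positive idempotent is its own positive square root. -/
theorem sqrt_rankOne_self {x : H} (hx : ‖x‖ = 1) : CFC.sqrt (rankOne ℂ x x) = rankOne ℂ x x :=
  CFC.sqrt_unique (isIdempotentElem_rankOne_self hx)
    ((ContinuousLinearMap.nonneg_iff_isPositive _).2 (isPositive_rankOne_self x))

theorem energyForm_smul {G : H →ₗ.[ℂ] H} (hG : IsPositiveSelfAdjoint G) {x : H}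
    (hx : x ∈ (posSqrt G hG).domain) (c : ℂ) :
    energyForm G hG (c • x) = ENNReal.ofReal (‖c‖ ^ 2 * ‖posSqrt G hG ⟨x, hx⟩‖ ^ 2) := by
  have h : c • x ∈ (posSqrt G hG).domain := Submodule.smul_mem _ c hx
  have h2 : (⟨c • x, h⟩ : (posSqrt G hG).domain) = c • ⟨x, hx⟩ := rfl
  rw [energyForm, dif_pos h, h2, LinearPMap.map_smul, ← ofReal_norm,
    ← ENNReal.ofReal_pow (norm_nonneg _), norm_smul, mul_pow]

/-- The square root of the projection sends each `eᵢ` to a multiple of `x`, so the value `∞` of the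
energy form never occurs, and by Parseval the energies of these multiples form a convergent series.
-/
theorem energy_rankOne_self_lt_top {G : H →ₗ.[ℂ] H} (hG : IsPositiveSelfAdjoint G) {x : H}
    (hx : ‖x‖ = 1) (hxG : x ∈ (posSqrt G hG).domain) : energy G hG (rankOne ℂ x x) < ∞ := by
  have hs : Summable fun i => ‖⟪x, stdBasis H i⟫_ℂ‖ ^ 2 * ‖posSqrt G hG ⟨x, hxG⟩‖ ^ 2 := by
    simpa only [norm_inner_symm] using
      ((stdBasis H).hasSum_norm_sq_inner x).summable.mul_right (‖posSqrt G hG ⟨x, hxG⟩‖ ^ 2)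
  simp only [energy, sqrt_rankOne_self hx, rankOne_apply, energyForm_smul hG hxG]
  rw [← ENNReal.ofReal_tsum_of_nonneg (fun i => by positivity) hs]
  exact ENNReal.ofReal_lt_top

theorem rankOne_self_mem_finiteEnergyStates {G : H →ₗ.[ℂ] H} (hG : IsPositiveSelfAdjoint G)
    {x : H} (hx : ‖x‖ = 1) (hxG : x ∈ (posSqrt G hG).domain) :
    rankOne ℂ x x ∈ finiteEnergyStates G hG :=
  ⟨isState_rankOne_self hx, energy_rankOne_self_lt_top hG hx hxG⟩

/-- All decompositions are allowed in `IsSandwich`, so it is enough to test `x, 0, 0, …` and use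
uniqueness of sums. -/
theorem IsSandwich.eq_rankOne {V : H →ₗ.[ℂ] K} {x : V.domain} {T : K →L[ℂ] K}
    (h : IsSandwich V (rankOne ℂ (x : H) (x : H)) T) : T = rankOne ℂ (V x) (V x) := by
  let φ : ℕ → V.domain := Pi.single 0 x
  have h0 : φ 0 = x := Pi.single_eq_same _ _
  have hn : ∀ n ≠ 0, φ n = 0 := fun n hn => Pi.single_eq_of_ne hn _
  have h1 : HasSum (fun i => rankOne ℂ (φ i : H) (φ i : H)) (rankOne ℂ (x : H) (x : H)) := by
    have := hasSum_single (f := fun i => rankOne ℂ (φ i : H) (φ i : H)) 0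
      fun n h => by simp [hn n h]
    rwa [h0] at this
  have h2 := hasSum_single (f := fun i => rankOne ℂ (V (φ i)) (V (φ i))) 0
    fun n h => by simp [hn n h]
  rw [h0] at h2
  exact (h φ h1).unique h2

end Traces

/-! ### Comparison of representing operators -/

section Representing

variable {HA HB HE HF : Type*}
  [NormedAddCommGroup HA] [InnerProductSpace ℂ HA] [CompleteSpace HA]
  [NormedAddCommGroup HB] [InnerProductSpace ℂ HB] [CompleteSpace HB]
  [NormedAddCommGroup HE] [InnerProductSpace ℂ HE] [CompleteSpace HE]
  [NormedAddCommGroup HF] [InnerProductSpace ℂ HF] [CompleteSpace HF]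
  {G : HA →ₗ.[ℂ] HA} {hG : IsPositiveSelfAdjoint G}
  {Φ : finiteEnergySpan G hG →ₗ[ℂ] traceClass HB}

/-- `Tr Φ(|x⟩⟨x|) = ‖V x‖²` for a representing operator `V` of `Φ`. -/
theorem IsRepresenting.opTrace_eq {V : HA →ₗ.[ℂ] HilbertTensor HB HE}
    (hV : IsRepresenting G hG Φ V) {x : HA} (hx : ‖x‖ = 1) (hxG : x ∈ (posSqrt G hG).domain)
    (hxV : x ∈ V.domain) :
    opTrace (Φ ⟨rankOne ℂ x x, Submodule.subset_span
      (rankOne_self_mem_finiteEnergyStates hG hx hxG)⟩ : HB →L[ℂ] HB) =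
      ((‖V ⟨x, hxV⟩‖ ^ 2 : ℝ) : ℂ) := by
  obtain ⟨T, hT, hΦ⟩ := hV.2 _ (rankOne_self_mem_finiteEnergyStates hG hx hxG)
  rw [hΦ, IsSandwich.eq_rankOne (x := ⟨x, hxV⟩) hT, opTrace_partialTrace_rankOne_self]

/-- Two representing operators of the same map have equal norms on the domain of `√G`. -/
theorem IsRepresenting.norm_apply_eq {V : HA →ₗ.[ℂ] HilbertTensor HB HE}
    {W : HA →ₗ.[ℂ] HilbertTensor HB HF} (hV : IsRepresenting G hG Φ V)
    (hW : IsRepresenting G hG Φ W) {x : HA} (hxG : x ∈ (posSqrt G hG).domain)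
    (hxV : x ∈ V.domain) (hxW : x ∈ W.domain) : ‖V ⟨x, hxV⟩‖ = ‖W ⟨x, hxW⟩‖ := by
  -- Only unit vectors give states, so zero is treated apart and any other `x` is normalised by `c =
  -- ‖x‖⁻¹`, which is cancelled at the end.
  obtain rfl | hx := eq_or_ne x 0
  · have h1 : V ⟨0, hxV⟩ = 0 := V.map_zero
    have h2 : W ⟨0, hxW⟩ = 0 := W.map_zero
    rw [h1, h2, norm_zero, norm_zero]
  have hx' : ‖x‖ ≠ 0 := norm_ne_zero_iff.2 hx
  let c : ℂ := (‖x‖ : ℂ)⁻¹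
  have hc : c ≠ 0 := inv_ne_zero (by exact_mod_cast hx')
  have hn : ‖c • x‖ = 1 := by
    rw [norm_smul, norm_inv, Complex.norm_real, norm_norm, inv_mul_cancel₀ hx']
  have h := (hV.opTrace_eq hn (Submodule.smul_mem _ c hxG) (Submodule.smul_mem _ c hxV)).symm.trans
    (hW.opTrace_eq hn (Submodule.smul_mem _ c hxG) (Submodule.smul_mem _ c hxW))
  have h1 : V ⟨c • x, Submodule.smul_mem _ c hxV⟩ = c • V ⟨x, hxV⟩ := V.map_smul c ⟨x, hxV⟩
  have h2 : W ⟨c • x, Submodule.smul_mem _ c hxW⟩ = c • W ⟨x, hxW⟩ := W.map_smul c ⟨x, hxW⟩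
  have h3 := (pow_left_inj₀ (norm_nonneg _) (norm_nonneg _) two_ne_zero).1 (Complex.ofReal_inj.1 h)
  rw [h1, h2, norm_smul, norm_smul] at h3
  exact mul_left_cancel₀ (norm_ne_zero_iff.2 hc) h3

theorem IsRepresenting.relBoundedBy_iff {V : HA →ₗ.[ℂ] HilbertTensor HB HE}
    {W : HA →ₗ.[ℂ] HilbertTensor HB HF} (hV : IsRepresenting G hG Φ V)
    (hW : IsRepresenting G hG Φ W) (a b : ℝ) :
    RelBoundedBy (posSqrt G hG) V a b ↔ RelBoundedBy (posSqrt G hG) W a b := by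
  constructor
  · intro h x hS hxW
    -- Relative boundedness puts `D(√G)` inside the domains of both operators, so their norms can be
    -- compared at `x`.
    rw [← hV.norm_apply_eq hW hS (hV.1.1 hS) hxW]
    exact h x hS _
  · intro h x hS hxV
    rw [hV.norm_apply_eq hW hS hxV (hW.1.1 hS)]
    exact h x hS _

/-- Both bounds are infima of the same set of numbers `b`. -/
theorem IsRepresenting.relBound_eq {V : HA →ₗ.[ℂ] HilbertTensor HB HE}
    {W : HA →ₗ.[ℂ] HilbertTensor HB HF} (hV : IsRepresenting G hG Φ V)
    (hW : IsRepresenting G hG Φ W) :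
    relBound (posSqrt G hG) V = relBound (posSqrt G hG) W := by
  simp only [relBound, hV.relBoundedBy_iff hW]

end Representing

theorem corollary2 {HA : Type uA} {HB : Type uB}
    [NormedAddCommGroup HA] [InnerProductSpace ℂ HA] [CompleteSpace HA]
    [TopologicalSpace.SeparableSpace HA]
    [NormedAddCommGroup HB] [InnerProductSpace ℂ HB] [CompleteSpace HB]
    [TopologicalSpace.SeparableSpace HB]
    (G : HA →ₗ.[ℂ] HA) (hG : IsPositiveSelfAdjoint G)
    (Φ : finiteEnergySpan G hG →ₗ[ℂ] traceClass HB)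
    (hΦ : Φ ∈ infinitesimalCone.{uE, uA, uB} HB G hG)
    (HE : Type uF) [NormedAddCommGroup HE] [InnerProductSpace ℂ HE] [CompleteSpace HE]
    [TopologicalSpace.SeparableSpace HE]
    (V : HA →ₗ.[ℂ] HilbertTensor HB HE) (hV : IsRepresenting G hG Φ V) :
    IsInfinitesimal (posSqrt G hG) V := by
  obtain ⟨HF, _, _, _, _, W, hW, hinf⟩ := hΦ
  exact ⟨hV.1, (hV.relBound_eq hW).trans hinf.2⟩
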